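/- Let $J$ be a finite set with $m=|J|\ge 3$, and let $h:2^J\to\mathbb N_0$ be the rank function of a uniform integer polymatroid on $J$, i.e. $h(\emptyset)=0$, $h$ is monotone and submodular, and $h(X)=h_{|X|}$ depends only on $|X|$. Put $g_i=h_{i+1}-h_i$ for $0\le i\le m-1$, $g_m=0$, and assume $$g_0\ge g_1=g_{m-1}>0 .$$ Let $P$ be a finite set of participants, partitioned into pairwise disjoint nonempty blocks $(P_x)_{x\in J}$ with $h(\{x\})\le|P_x|$ for all $x\in J$. Let $\Delta\subseteq 2^J\setminus\{\emptyset\}$ be a nonempty monotone increasing family compatible with $h$: for a new point $x_0\notin J$, the function $h'$ on $2^{J\cup\{x_0\}}$ given, for $X\subseteq J$, by $h'(X)=h(X)$, $h'(X\cup\{x_0\})=h(X)$ if $X\in\Delta$ and $h'(X\cup\{x_0\})=h(X)+1$ if $X\notin\Delta$, is monotone and submodular. For $X\subseteq J$ let $$\mathcal B(h,X)=\Big\{v\in\mathbb N_0^J:\ \operatorname{supp}v\subseteq X,\ \sum_{x\in J}v_x=h(X),\ \sum_{x\in Y}v_x\le h(Y)\ \text{for all } Y\subseteq X\Big\},$$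 and let $\Gamma$ be the family of all $A\subseteq P$ such that $(|A\cap P_x|)_{x\in J}\ge w$ coordinatewise for some minimal element $w$ of $\bigcup_{X\in\Delta}\mathcal B(h,X)$. Then $\Gamma$ is an access structure on $P$ (it is monotone increasing, $\emptyset\notin\Gamma$ and $P\in\Gamma$), and it is ideal: there are a finite set $S_0$ of secrets with $|S_0|\ge2$, finite sets $S_p$ $(p\in P)$ with $|S_p|=|S_0|$, and for each secret $s\in S_0$ a probability distribution on $\prod_{p\in P}S_p$ (the shares dealt when the secret is $s$), such that every element of $S_p$ occurs with positive probability as the share of $p$ for some secret, the shares of the members of any $A\in\Gamma$ determine the secret, and for every $A\subseteq P$ with $A\notin\Gamma$ the joint distribution of the shares of the members of $A$ does not depend on the secret. -/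

import Mathlib

/-! ### Access structures and secret sharing schemes -/

/-- An access structure on the set of participants `P`: a monotone increasing family of subsets
of `P` which contains `P` but not the empty set. -/
structure IsAccessStructure {P : Type*} [Fintype P] (Γ : Set (Finset P)) : Prop where
  monotone : ∀ A B : Finset P, A ⊆ B → A ∈ Γ → B ∈ Γ
  empty_notMem : ∅ ∉ Γ
  univ_mem : Finset.univ ∈ Γ

/-- A secret sharing scheme with set of participants `P`. `Secret` is the set of possible secrets
(at least two), `Share p` is the set of all possible values of the share of `p`, and `deal s` is the
joint probability distribution of the vector of shares that the dealer hands out when the secret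
is `s`. Every element of `Share p` really occurs as a share of `p`. -/
structure SecretSharingScheme (P : Type*) where
  Secret : Type
  Share : P → Type
  finite_secret : Finite Secret
  finite_share : ∀ p, Finite (Share p)
  nontrivial_secret : Nontrivial Secret
  deal : Secret → PMF (∀ p, Share p)
  share_occurs : ∀ (p : P) (c : Share p), ∃ s, ∃ f ∈ (deal s).support, f p = c

namespace SecretSharingScheme

variable {P : Type*}

/-- The joint distribution of the shares of the participants in `A`, given the secret `s`. -/
noncomputable def sharesOf (S : SecretSharingScheme P) (A : Finset P) (s : S.Secret) :
    PMF (∀ p : A, S.Share p) :=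
  (S.deal s).map (fun f (p : A) => f p)

/-- The participants in `A` can compute the secret by pooling their shares. -/
def Recovers (S : SecretSharingScheme P) (A : Finset P) : Prop :=
  ∃ rec : (∀ p : A, S.Share p) → S.Secret,
    ∀ s, ∀ v ∈ (S.sharesOf A s).support, rec v = s

/-- The shares of the participants in `A` carry no information about the secret: their joint
distribution does not depend on the secret. -/
def LearnsNothing (S : SecretSharingScheme P) (A : Finset P) : Prop :=
  ∀ s t, S.sharesOf A s = S.sharesOf A t

/-- `S` is a perfect secret sharing scheme with access structure `Γ`. -/
def IsPerfectFor (S : SecretSharingScheme P) (Γ : Set (Finset P)) : Prop :=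
  (∀ A ∈ Γ, S.Recovers A) ∧ ∀ A ∉ Γ, S.LearnsNothing A

end SecretSharingScheme

/-- The family `Γ` is ideal: it is the access structure of a perfect secret sharing scheme in which
every participant has exactly as many possible shares as there are possible secrets. -/
def IsIdealFamily {P : Type*} (Γ : Set (Finset P)) : Prop :=
  ∃ S : SecretSharingScheme P, S.IsPerfectFor Γ ∧
    ∀ p, Nat.card (S.Share p) = Nat.card S.Secret

/-! ### Integer polymatroids -/

/-- `h` is the rank function of an integer polymatroid with ground set `J` (the values are
nonnegative because `h ∅ = 0` and `h` is monotone). -/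
structure IsPolymatroid {J : Type*} [DecidableEq J] (h : Finset J → ℕ) : Prop where
  empty : h ∅ = 0
  monotone : ∀ X Y : Finset J, X ⊆ Y → h X ≤ h Y
  submodular : ∀ X Y : Finset J, h (X ∩ Y) + h (X ∪ Y) ≤ h X + h Y

/-- An integer polymatroid is uniform if the rank of a set depends only on its cardinality. -/
structure IsUniformPolymatroid {J : Type*} [DecidableEq J] (h : Finset J → ℕ) : Prop
    extends IsPolymatroid h where
  uniform : ∀ X Y : Finset J, X.card = Y.card → h X = h Y

/-- `g` is the increment sequence of the uniform polymatroid `(J, h)`: with `m = |J|` and `h_i` the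
common rank of the `i`-element sets, `g i = h_{i+1} - h_i` for `i < m`, and `g m = 0`. -/
def IsIncrementSequence {J : Type*} [Fintype J] (h : Finset J → ℕ)
    (g : Fin (Fintype.card J + 1) → ℕ) : Prop :=
  (∀ (i : Fin (Fintype.card J)) (X Y : Finset J), X.card = i → Y.card = i + 1 →
    (g i.castSucc : ℤ) = h Y - h X) ∧
  g (Fin.last _) = 0

open Classical in
/-- The rank function, on the ground set `J ∪ {x₀}` with `x₀ = none`, of the extension of `h`
by `Δ`: sets avoiding `x₀` keep their rank, and adding `x₀` to `X ⊆ J` increases the rank by `0`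
if `X ∈ Δ` and by `1` otherwise. -/
noncomputable def extensionRank {J : Type*} (h : Finset J → ℕ) (Δ : Set (Finset J))
    (Z : Finset (Option J)) : ℕ :=
  h (Finset.eraseNone Z) + if none ∈ Z ∧ Finset.eraseNone Z ∉ Δ then 1 else 0

/-- `Δ` is a monotone increasing family of nonempty subsets of `J` which is compatible with the
polymatroid `(J, h)`: the extension of `h` by `Δ` is again a polymatroid. -/
structure IsCompatible {J : Type*} [DecidableEq J] (h : Finset J → ℕ) (Δ : Set (Finset J)) :
    Prop where
  monotone : ∀ X Y : Finset J, X ⊆ Y → X ∈ Δ → Y ∈ Δ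
  empty_notMem : ∅ ∉ Δ
  extension : IsPolymatroid (extensionRank h Δ)

/-- The set `B(h, X)` of all integer vectors `v ≥ 0` with support in `X`, `|v| = h(X)` and
`|v_Y| ≤ h(Y)` for all `Y ⊆ X`. -/
def polyBases {J : Type*} [Fintype J] (h : Finset J → ℕ) (X : Finset J) : Set (J → ℕ) :=
  {v | (∀ x, v x ≠ 0 → x ∈ X) ∧ ∑ x, v x = h X ∧ ∀ Y ⊆ X, ∑ x ∈ Y, v x ≤ h Y}

/-! ### Multipartite access structures determined by a polymatroid -/

/-- A partition `(P_x)_{x ∈ J}` of `P` into pairwise disjoint nonempty blocks. -/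
structure IsBlockPartition {J P : Type*} (block : J → Finset P) : Prop where
  nonempty : ∀ x, (block x).Nonempty
  disjoint : ∀ x y, x ≠ y → Disjoint (block x) (block y)
  cover : ∀ p, ∃ x, p ∈ block x

/-- The vector `π(A) = (|A ∩ P_x|)_{x ∈ J}`. -/
def blockVector {J P : Type*} [DecidableEq P] (block : J → Finset P) (A : Finset P) : J → ℕ :=
  fun x => (A ∩ block x).card

/-- The family `Γ(Π, h, Δ)` of subsets of `P` determined by the partition, the polymatroid
and `Δ`: the sets `A` whose vector `π(A)` dominates a minimal element of `⋃_{X ∈ Δ} B(h, X)`. -/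
def determinedFamily {J P : Type*} [Fintype J] [DecidableEq P] (block : J → Finset P)
    (h : Finset J → ℕ) (Δ : Set (Finset J)) : Set (Finset P) :=
  {A | ∃ w : J → ℕ, Minimal (fun v => v ∈ ⋃ X ∈ Δ, polyBases h X) w ∧ w ≤ blockVector block A}

/-! By submodularity the increments are nonincreasing, so `g_1 = g_{m-1}` makes them constant after
the first: `h X = |X| k + r` for nonempty `X`. This counts a union of sets, each with `r` common and
`k` private elements (`card_biUnion_commonAndOwn`). Compatibility forces `Δ` to be principal or the
family of all nonempty sets (`IsCompatible.eq_principal_or_nonempty`); either way `Y ∈ Δ` says that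
the union over `Y` contains a fixed set `D`. Coordinate subspaces thus represent `h` over every
field, and the indicator vector of `D` represents the extension.

Over a large prime field, pick for each participant a generic vector in the subspace of its block. A
Rado-type rank bound (`exists_points_in_general_position`) shows that `Γ` consists of the sets whose
vectors span the indicator vector `a`. A functional `φ` with secret `φ a` and shares `φ (v p)` then
gives an ideal scheme. -/

/-! ### The linear secret sharing scheme of a vector configuration -/

section LinearScheme

variable {F V P : Type*} [Field F] [AddCommGroup V] [Module F V]

theorem exists_dual_eq_one_of_notMem_span {s : Set V} {a : V} (ha : a ∉ Submodule.span F s) :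
    ∃ φ : Module.Dual F V, φ a = 1 ∧ ∀ b ∈ s, φ b = 0 := by
  obtain ⟨f, hfa, hf⟩ := Submodule.exists_le_ker_of_notMem ha
  refine ⟨(f a)⁻¹ • f, by simp [hfa], fun b hb => ?_⟩
  have : f b = 0 := hf (Submodule.subset_span hb)
  simp [this]

theorem PMF.map_equiv_uniformOfFintype {α : Type*} [Fintype α] [Nonempty α] (e : α ≃ α) :
    (PMF.uniformOfFintype α).map e = PMF.uniformOfFintype α := by
  ext b
  rw [PMF.map_apply, tsum_eq_single (e.symm b)]
  · simp
  · intro a ha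
    rw [if_neg]
    rintro rfl
    simp at ha

/-- A family `Γ` of sets is ideal if there are vectors `v p` over a finite field such that the sets
in `Γ` are those whose vectors span a fixed vector `a`. -/
theorem isIdealFamily_of_mem_span {K : Type} [Field K] [Finite K] [Module K V] [Finite V]
    (Γ : Set (Finset P)) (v : P → V) (a : V) (ha : a ≠ 0) (hv : ∀ p, v p ≠ 0)
    (hΓ : ∀ A : Finset P, A ∈ Γ ↔ a ∈ Submodule.span K (v '' A)) : IsIdealFamily Γ := by
  classical
  have hexists : ∀ b : V, b ≠ 0 → ∃ φ : Module.Dual K V, φ b = 1 := fun b hb => by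
    obtain ⟨φ, hφ, -⟩ := exists_dual_eq_one_of_notMem_span (F := K) (s := ∅) (a := b) (by simpa)
    exact ⟨φ, hφ⟩
  obtain ⟨φ₀, hφ₀⟩ := hexists a ha
  have : Finite (Module.Dual K V) := Finite.of_injective _ DFunLike.coe_injective
  let N : Submodule K (Module.Dual K V) := LinearMap.ker (Module.Dual.eval K V a)
  have hN : ∀ φ, φ ∈ N ↔ φ a = 0 := fun φ => Iff.rfl
  let : Fintype N := Fintype.ofFinite N
  let S : SecretSharingScheme P :=
    { Secret := K
      Share := fun _ => K
      finite_secret := inferInstance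
      finite_share := fun _ => inferInstance
      nontrivial_secret := inferInstance
      -- A uniformly random functional among those taking the value `s` at `a`.
      deal := fun s => (PMF.uniformOfFintype N).map fun φ p => (φ.1 + s • φ₀) (v p)
      share_occurs := by
        intro p c
        obtain ⟨ψ, hψ⟩ := hexists (v p) (hv p)
        refine ⟨(c • ψ) a, fun q => (c • ψ) (v q), ?_, by simp [hψ]⟩
        rw [PMF.mem_support_map_iff]
        refine ⟨⟨c • ψ - (c • ψ) a • φ₀, ?_⟩, by simp, ?_⟩
        · rw [hN]
          simp [hφ₀]
        · funext q
          simp }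
  refine ⟨S, ⟨fun A hA => ?_, fun A hA s t => ?_⟩, fun p => rfl⟩
  · have ha' := (hΓ A).1 hA
    -- Functionals that agree on the shares of `A` agree on the span, hence at `a`. The default `0`
    -- is never used on shares that were dealt.
    refine ⟨fun w => if hw : ∃ φ : Module.Dual K V, ∀ p : A, φ (v p) = w p
      then hw.choose a else (0 : K), fun s w hw => ?_⟩
    simp only [SecretSharingScheme.sharesOf, S, PMF.map_comp] at hw
    obtain ⟨φ, -, rfl⟩ := (PMF.mem_support_map_iff _ _ _).1 hw
    have hex : ∃ ψ : Module.Dual K V, ∀ p : A, ψ (v p) = (φ.1 + s • φ₀) (v p) :=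
      ⟨φ.1 + s • φ₀, fun _ => rfl⟩
    have heq : Set.EqOn hex.choose (φ.1 + s • φ₀) (Submodule.span K (v '' A)) := by
      refine LinearMap.eqOn_span' (f := hex.choose) (g := φ.1 + s • φ₀) ?_
      rintro _ ⟨p, hp, rfl⟩
      exact hex.choose_spec ⟨p, hp⟩
    have hs : (φ.1 + s • φ₀) a = s := by
      have := (hN φ.1).1 φ.2
      simp [this, hφ₀]
    exact (dif_pos hex).trans ((heq ha').trans hs)
  · obtain ⟨ψ, hψa, hψ⟩ := exists_dual_eq_one_of_notMem_span (F := K) (mt (hΓ A).2 hA)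
    -- Translation by this element turns secret `t` into secret `s` without changing any share in
    -- `A`, since `ψ` vanishes there.
    have hmem : (s - t) • (φ₀ - ψ) ∈ N := by
      rw [hN]
      simp [hφ₀, hψa]
    simp only [SecretSharingScheme.sharesOf, S, PMF.map_comp]
    conv_rhs => rw [← PMF.map_equiv_uniformOfFintype
      (Equiv.addRight (⟨(s - t) • (φ₀ - ψ), hmem⟩ : N)), PMF.map_comp]
    congr 1
    funext φ p
    have hp : ψ (v p) = 0 := hψ _ ⟨p, p.2, rfl⟩
    simp [hp]
    ring

end LinearScheme

/-! ### Vectors in general position in a family of subspaces -/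

section GeneralPosition

open Module

variable {F V J P κ : Type*} [Field F] [AddCommGroup V] [Module F V]

/-- Each `U ⊓ W i` is proper in `U`, so it holds at most a fraction `1/|F|` of `U`; fewer than `|F|`
of them cannot cover `U`. -/
theorem Submodule.exists_mem_forall_notMem_of_card_lt [Finite F] [Finite V] {ι : Type*}
    [Fintype ι] (U : Submodule F V) (W : ι → Submodule F V) (hcard : Fintype.card ι < Nat.card F)
    (hW : ∀ i, ¬ U ≤ W i) : ∃ u ∈ U, ∀ i, u ∉ W i := by
  classical
  have : Fintype V := Fintype.ofFinite V
  have : Fintype F := Fintype.ofFinite F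
  by_contra! hcon
  have hsub : (Finset.univ.filter (· ∈ U)) ⊆
      Finset.univ.biUnion fun i => Finset.univ.filter (· ∈ U ⊓ W i) := by
    intro u hu
    obtain ⟨i, hi⟩ := hcon u (by simpa using hu)
    simp only [Finset.mem_biUnion, Finset.mem_filter, Finset.mem_univ, true_and]
    exact ⟨i, by simpa using hu, hi⟩
  have hc : ∀ X : Submodule F V,
      (Finset.univ.filter (· ∈ X)).card = Nat.card F ^ finrank F X := by
    intro X
    rw [← Fintype.card_subtype, Nat.card_eq_fintype_card]
    exact Module.card_eq_pow_finrank
  have hq : 0 < Nat.card F := Nat.card_pos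
  have hle : ∀ i, (Finset.univ.filter (· ∈ U ⊓ W i)).card * Nat.card F ≤
      (Finset.univ.filter (· ∈ U)).card := by
    intro i
    rw [hc, hc, ← pow_succ]
    refine Nat.pow_le_pow_right hq (Submodule.finrank_lt_finrank_of_lt ?_)
    exact lt_of_le_of_ne inf_le_left fun he => hW i (inf_eq_left.1 he)
  have h1 := (Finset.card_le_card hsub).trans Finset.card_biUnion_le
  have hpos : 0 < (Finset.univ.filter (· ∈ U)).card := by
    rw [hc]
    exact pow_pos hq _
  have h2 : (Finset.univ.filter (· ∈ U)).card * Nat.card F ≤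
      Fintype.card ι * (Finset.univ.filter (· ∈ U)).card := by
    calc _ ≤ (∑ i, (Finset.univ.filter (· ∈ U ⊓ W i)).card) * Nat.card F :=
          Nat.mul_le_mul_right _ h1
      _ ≤ ∑ _i : ι, (Finset.univ.filter (· ∈ U)).card := by
          rw [Finset.sum_mul]
          exact Finset.sum_le_sum fun i _ => hle i
      _ = _ := by simp
  rw [mul_comm] at h2
  exact absurd (Nat.le_of_mul_le_mul_right h2 hpos) (not_le.2 hcard)

/-- Over a large finite field there are vectors `v p ∈ W (x p)` such that adjoining them to any of
the subspaces `U c ⊔ ⨆ j ∈ Y, W j` yields at least the rank given by Rado's formula. -/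
theorem exists_points_in_general_position [Finite F] [Finite V] [Fintype J] [Fintype P]
    [Fintype κ] [DecidableEq J] [DecidableEq P] (x : P → J) (W : J → Submodule F V)
    (U : κ → Submodule F V)
    (hcard : Fintype.card (Finset P × Finset J × κ) < Nat.card F) (s : Finset P) :
    ∃ v : P → V, (∀ p ∈ s, v p ∈ W (x p)) ∧ ∀ A ⊆ s, ∀ (Y : Finset J) (c : κ), ∃ T ⊆ A,
      finrank F ↥(U c ⊔ (Y ∪ T.image x).sup W) + (A \ T).card ≤
        finrank F ↥(U c ⊔ Y.sup W ⊔ Submodule.span F (v '' A)) := by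
  classical
  induction s using Finset.induction_on with
  | empty =>
    refine ⟨fun _ => 0, by simp, fun A hA Y c => ⟨∅, by simp, ?_⟩⟩
    obtain rfl := Finset.subset_empty.1 hA
    rw [Finset.sdiff_self, Finset.card_empty, add_zero, Finset.image_empty, Finset.union_empty]
    exact Submodule.finrank_mono le_sup_left
  | insert p s hps ih =>
    obtain ⟨v, hvW, hv⟩ := ih
    let B : Finset P × Finset J × κ → Submodule F V := fun i =>
      U i.2.2 ⊔ i.2.1.sup W ⊔ Submodule.span F (v '' i.1)
    obtain ⟨u, huW, hu⟩ := Submodule.exists_mem_forall_notMem_of_card_lt (W (x p))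
      (fun i : {i // ¬ W (x p) ≤ B i} => B i.1)
      ((Fintype.card_subtype_le _).trans_lt hcard) (fun i => i.2)
    have himage : ∀ A ⊆ s, Function.update v p u '' A = v '' A := fun A hA =>
      Set.image_congr fun q hq => Function.update_of_ne (by rintro rfl; exact hps (hA hq)) _ _
    refine ⟨Function.update v p u, fun q hq => ?_, fun A hA Y c => ?_⟩
    · rcases Finset.mem_insert.1 hq with rfl | hq
      · simpa using huW
      · rw [Function.update_of_ne (ne_of_mem_of_not_mem hq hps)]
        exact hvW q hq
    by_cases hpA : p ∈ A
    swap
    · have hAs : A ⊆ s := (Finset.subset_insert_iff_of_notMem hpA).1 hA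
      rw [himage A hAs]
      exact hv A hAs Y c
    obtain ⟨A, hp', rfl⟩ : ∃ A', p ∉ A' ∧ A = insert p A' :=
      ⟨A.erase p, Finset.notMem_erase p A, (Finset.insert_erase hpA).symm⟩
    have hAs : A ⊆ s := by
      rw [Finset.insert_subset_insert_iff hp'] at hA
      exact hA
    rw [Finset.coe_insert, Set.image_insert_eq, himage A hAs, Function.update_self,
      Submodule.span_insert]
    -- If `W (x p)` already lies in the span, `x p` can be absorbed into `Y` and `p` joins `T`.
    -- Otherwise the generic `u` raises the rank by one and `p` is counted in `A \ T`.
    by_cases hle : W (x p) ≤ B (A, Y, c)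
    · obtain ⟨T, hTA, hT⟩ := hv A hAs (insert (x p) Y) c
      refine ⟨insert p T, Finset.insert_subset_insert _ hTA, ?_⟩
      have h1 : Y ∪ (insert p T).image x = insert (x p) Y ∪ T.image x := by
        rw [Finset.image_insert, Finset.union_insert, Finset.insert_union]
      have h2 : insert p A \ insert p T = A \ T := by
        rw [Finset.insert_sdiff_insert, Finset.sdiff_insert_of_notMem hp']
      rw [h1, h2]
      refine hT.trans (Submodule.finrank_mono ?_)
      rw [Finset.sup_insert]
      refine sup_le (sup_le (le_sup_of_le_left le_sup_left) (sup_le ?_ ?_)) ?_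
      · exact hle.trans (sup_le_sup_left le_sup_right _)
      · exact le_sup_of_le_left le_sup_right
      · exact le_sup_of_le_right le_sup_right
    · obtain ⟨T, hTA, hT⟩ := hv A hAs Y c
      refine ⟨T, hTA.trans (Finset.subset_insert _ _), ?_⟩
      have hlt : finrank F ↥(U c ⊔ Y.sup W ⊔ Submodule.span F (v '' A)) <
          finrank F ↥(U c ⊔ Y.sup W ⊔ (Submodule.span F {u} ⊔ Submodule.span F (v '' A))) := by
        refine Submodule.finrank_lt_finrank_of_lt (lt_of_le_of_ne ?_ fun he => ?_)
        · exact sup_le_sup_left le_sup_right _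
        · refine hu ⟨(A, Y, c), hle⟩ ?_
          change u ∈ U c ⊔ Y.sup W ⊔ Submodule.span F (v '' A)
          rw [he]
          exact Submodule.mem_sup_right
            (Submodule.mem_sup_left (Submodule.mem_span_singleton_self u))
      have h3 : (insert p A \ T).card = (A \ T).card + 1 := by
        rw [Finset.insert_sdiff_of_notMem _ fun hp => hp' (hTA hp), Finset.card_insert_of_notMem]
        exact fun hp => hp' (Finset.mem_sdiff.1 hp).1
      omega

end GeneralPosition

/-! ### Ideal families from linear representations of a polymatroid and its extension -/

section Representation

open Module

theorem Finset.sum_card_filter_eq {J P : Type*} [DecidableEq J] (x : P → J) (A : Finset P)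
    (Y : Finset J) : ∑ j ∈ Y, (A.filter (x · = j)).card = (A.filter (x · ∈ Y)).card := by
  rw [Finset.card_eq_sum_card_fiberwise (s := A.filter (x · ∈ Y)) (f := x) (t := Y)
    fun p hp => (Finset.mem_filter.1 hp).2]
  refine Finset.sum_congr rfl fun j hj => ?_
  congr 1
  ext p
  simp only [Finset.mem_filter]
  constructor
  · rintro ⟨hp, rfl⟩
    exact ⟨⟨hp, hj⟩, rfl⟩
  · rintro ⟨⟨hp, -⟩, rfl⟩
    exact ⟨hp, rfl⟩

theorem Finset.exists_subset_card_filter_eq {J P : Type*} [Fintype J] [DecidableEq J]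
    [DecidableEq P] (x : P → J) (A : Finset P) (w : J → ℕ)
    (hw : ∀ j, w j ≤ (A.filter (x · = j)).card) :
    ∃ B ⊆ A, ∀ j, (B.filter (x · = j)).card = w j := by
  choose T hTA hT using fun j => Finset.exists_subset_card_eq (hw j)
  refine ⟨Finset.univ.biUnion T, ?_, fun j => ?_⟩
  · refine Finset.biUnion_subset.2 fun j _ => (hTA j).trans (Finset.filter_subset _ _)
  · rw [← hT j]
    congr 1
    ext p
    simp only [Finset.mem_filter, Finset.mem_biUnion, Finset.mem_univ, true_and]
    constructor
    · rintro ⟨⟨i, hi⟩, rfl⟩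
      have := (Finset.mem_filter.1 (hTA i hi)).2
      rwa [this]
    · exact fun hp => ⟨⟨j, hp⟩, (Finset.mem_filter.1 (hTA j hp)).2⟩

theorem mem_determinedFamily_iff {J P : Type*} [Fintype J] [DecidableEq P] {block : J → Finset P}
    {h : Finset J → ℕ} {Δ : Set (Finset J)} {A : Finset P} :
    A ∈ determinedFamily block h Δ ↔
      ∃ X ∈ Δ, ∃ w ∈ polyBases h X, w ≤ blockVector block A := by
  constructor
  · rintro ⟨w, hw, hwA⟩
    obtain ⟨X, hX, hwX⟩ := Set.mem_iUnion₂.1 hw.prop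
    exact ⟨X, hX, w, hwX, hwA⟩
  · rintro ⟨X, hX, w, hwX, hwA⟩
    obtain ⟨u, huw, hu⟩ := exists_minimal_le_of_wellFoundedLT
      (fun v => v ∈ ⋃ X ∈ Δ, polyBases h X) w (Set.mem_iUnion₂.2 ⟨X, hX, hwX⟩)
    exact ⟨u, hu, huw.trans hwA⟩

theorem IsBlockPartition.exists_index {J P : Type*} {block : J → Finset P}
    (hblock : IsBlockPartition block) : ∃ x : P → J, ∀ p j, p ∈ block j ↔ x p = j := by
  choose x hx using hblock.cover
  refine ⟨x, fun p j => ⟨fun hp => ?_, fun hp => hp ▸ hx p⟩⟩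
  by_contra hne
  exact Finset.disjoint_left.1 (hblock.disjoint _ _ hne) (hx p) hp

theorem blockVector_eq_card_filter {J P : Type*} [DecidableEq J] [DecidableEq P]
    {block : J → Finset P} {x : P → J} (hx : ∀ p j, p ∈ block j ↔ x p = j) (A : Finset P) (j : J) :
    blockVector block A j = (A.filter (x · = j)).card := by
  rw [blockVector]
  congr 1
  ext p
  simp [hx]

theorem span_image_le_sup {F V J P : Type*} [Field F] [AddCommGroup V] [Module F V]
    [DecidableEq J] {x : P → J} {W : J → Submodule F V} {v : P → V}
    (hv : ∀ p, v p ∈ W (x p)) (T : Finset P) :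
    Submodule.span F (v '' T) ≤ (T.image x).sup W := by
  rw [Submodule.span_le]
  rintro _ ⟨p, hp, rfl⟩
  exact Finset.le_sup (f := W) (Finset.mem_image_of_mem x hp) (hv p)

/-- If the subspaces `W j` over a large finite field represent `h`, and the vector `a` represents
the extension by `Δ`, then vectors in general position in the subspaces realize the determined
family. -/
theorem exists_realization_of_subspaces {F V J P : Type*} [Field F] [Finite F] [AddCommGroup V]
    [Module F V] [Finite V] [Fintype J] [DecidableEq J] [Fintype P] [DecidableEq P]
    (hcard : Fintype.card (Finset P × Finset J × Bool) < Nat.card F)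
    {block : J → Finset P} (hblock : IsBlockPartition block) {h : Finset J → ℕ}
    (hpos : ∀ j, 0 < h {j}) {Δ : Set (Finset J)} (W : J → Submodule F V) (a : V)
    (hW : ∀ Y : Finset J, finrank F ↥(Y.sup W) = h Y) (ha : ∀ Y : Finset J, a ∈ Y.sup W ↔ Y ∈ Δ) :
    ∃ v : P → V, (∀ p, v p ≠ 0) ∧
      ∀ A, A ∈ determinedFamily block h Δ ↔ a ∈ Submodule.span F (v '' A) := by
  obtain ⟨x, hx⟩ := hblock.exists_index
  -- The index `true` adjoins the line of `a`, `false` adjoins nothing; both rank bounds are needed.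
  obtain ⟨v, hvW, hv⟩ := exists_points_in_general_position x W
    (fun b : Bool => if b then Submodule.span F {a} else ⊥) hcard Finset.univ
  replace hvW : ∀ p, v p ∈ W (x p) := fun p => hvW p (Finset.mem_univ p)
  have hrank : ∀ A : Finset P, ∃ T ⊆ A, h (T.image x) + (A \ T).card ≤
      finrank F ↥(Submodule.span F (v '' A)) := by
    intro A
    obtain ⟨T, hTA, hT⟩ := hv A (Finset.subset_univ A) ∅ false
    rw [if_neg Bool.false_ne_true, Finset.empty_union, bot_sup_eq, hW, Finset.sup_empty,
      bot_sup_eq, bot_sup_eq] at hT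
    exact ⟨T, hTA, hT⟩
  have hrank' : ∀ A : Finset P, a ∈ Submodule.span F (v '' A) → ∃ T ⊆ A,
      finrank F ↥(Submodule.span F {a} ⊔ (T.image x).sup W) + (A \ T).card ≤
        finrank F ↥(Submodule.span F (v '' A)) := by
    intro A haA
    obtain ⟨T, hTA, hT⟩ := hv A (Finset.subset_univ A) ∅ true
    have hsup : Submodule.span F {a} ⊔ Submodule.span F (v '' A) = Submodule.span F (v '' A) :=
      sup_eq_right.2 ((Submodule.span_singleton_le_iff_mem _ _).2 haA)
    rw [if_pos rfl, Finset.empty_union, Finset.sup_empty, sup_bot_eq, hsup] at hT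
    exact ⟨T, hTA, hT⟩
  refine ⟨v, fun p hp => ?_, fun A => ?_⟩
  · obtain ⟨T, hT, hle⟩ := hrank {p}
    rw [Finset.coe_singleton, Set.image_singleton, hp, Submodule.span_zero_singleton,
      finrank_bot] at hle
    rcases Finset.subset_singleton_iff.1 hT with rfl | rfl
    · simp at hle
    · have := hpos (x p)
      simp at hle
      omega
  rw [mem_determinedFamily_iff]
  constructor
  · rintro ⟨X, hX, w, ⟨hwX, hsum, hwY⟩, hwA⟩
    obtain ⟨B, hBA, hB⟩ := Finset.exists_subset_card_filter_eq x A w fun j =>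
      (hwA j).trans_eq (blockVector_eq_card_filter hx A j)
    have hBsum : ∀ Y : Finset J, ∑ j ∈ Y, w j = (B.filter (x · ∈ Y)).card := fun Y => by
      rw [← Finset.sum_card_filter_eq]
      exact Finset.sum_congr rfl fun j _ => (hB j).symm
    have hBX : ∀ p ∈ B, x p ∈ X := by
      intro p hp
      refine hwX _ ?_
      rw [← hB]
      exact Finset.card_ne_zero_of_mem (Finset.mem_filter.2 ⟨hp, rfl⟩)
    have hBcard : B.card = h X := by
      rw [← hsum, hBsum]
      simp
    -- The inequalities on `w` give `|T| ≤ h (T.image x)`, so `B` has rank at least `|B| = h X` and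
    -- spans all of `X.sup W`, which contains `a`.
    obtain ⟨T, hTB, hT⟩ := hrank B
    have hTX : T.image x ⊆ X := by
      intro j hj
      obtain ⟨p, hp, rfl⟩ := Finset.mem_image.1 hj
      exact hBX p (hTB hp)
    have hTle : T.card ≤ h (T.image x) := by
      refine le_trans ?_ (hwY _ hTX)
      rw [hBsum]
      exact Finset.card_le_card fun p hp =>
        Finset.mem_filter.2 ⟨hTB hp, Finset.mem_image_of_mem x hp⟩
    have hBT := Finset.card_sdiff_add_card_eq_card hTB
    have heq : Submodule.span F (v '' B) = X.sup W := by
      refine Submodule.eq_of_le_of_finrank_le ((span_image_le_sup hvW B).trans ?_) ?_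
      · exact Finset.sup_mono fun j hj => by
          obtain ⟨p, hp, rfl⟩ := Finset.mem_image.1 hj
          exact hBX p hp
      · rw [hW]
        omega
    refine Submodule.span_mono (Set.image_mono (Finset.coe_subset.2 hBA)) ?_
    rw [heq]
    exact (ha X).2 hX
  · intro haA
    obtain ⟨b, hbA, -, hspan, hli⟩ := exists_linearIndepOn_extension
      (linearIndepOn_empty F v) (Set.empty_subset (A : Set P))
    obtain ⟨B, rfl⟩ : ∃ B : Finset P, (B : Set P) = b := ⟨b.toFinite.toFinset, by simp⟩
    have hindep : ∀ T ⊆ B, finrank F ↥(Submodule.span F (v '' T)) = T.card := by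
      intro T hT
      have hliT : LinearIndepOn F v (T : Set P) := hli.mono (Finset.coe_subset.2 hT)
      have := finrank_span_eq_card (hliT : LinearIndependent F fun p : (T : Set P) => v p)
      rw [← Set.image_eq_range] at this
      simpa using this
    have hindep_le : ∀ T ⊆ B, T.card ≤ h (T.image x) := by
      intro T hT
      rw [← hindep T hT, ← hW]
      exact Submodule.finrank_mono (span_image_le_sup hvW T)
    have haB : a ∈ Submodule.span F (v '' B) := Submodule.span_le.2 hspan haA
    -- With `B` independent and `a` in its span, the subspaces met by `T` together with `a` have
    -- dimension at most `|T|`, while `T` alone already has that rank. Hence `a` lies in their sum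
    -- and the block counts of `T` form a base.
    obtain ⟨T, hTB, hT⟩ := hrank' B haB
    have hBT := Finset.card_sdiff_add_card_eq_card hTB
    rw [hindep B subset_rfl] at hT
    have hTle := hindep_le T hTB
    have hsup : (T.image x).sup W = Submodule.span F {a} ⊔ (T.image x).sup W := by
      refine Submodule.eq_of_le_of_finrank_le le_sup_right ?_
      rw [hW]
      omega
    have hTΔ : T.image x ∈ Δ := by
      rw [← ha, hsup]
      exact Submodule.mem_sup_left (Submodule.mem_span_singleton_self a)
    have hTcard : T.card = h (T.image x) := by
      rw [← hsup, hW] at hT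
      omega
    refine ⟨T.image x, hTΔ, fun j => (T.filter (x · = j)).card, ⟨fun j hj => ?_, ?_, ?_⟩, ?_⟩
    · obtain ⟨p, hp⟩ := Finset.card_ne_zero.1 hj
      obtain ⟨hp', rfl⟩ := Finset.mem_filter.1 hp
      exact Finset.mem_image_of_mem x hp'
    · rw [Finset.sum_card_filter_eq, ← hTcard]
      simp
    · intro Y hY
      rw [Finset.sum_card_filter_eq]
      refine (hindep_le _ ((Finset.filter_subset _ _).trans hTB)).trans ?_
      rw [← hW, ← hW]
      refine Submodule.finrank_mono (Finset.sup_mono fun j hj => ?_)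
      obtain ⟨p, hp, rfl⟩ := Finset.mem_image.1 hj
      exact (Finset.mem_filter.1 hp).2
    · intro j
      rw [blockVector_eq_card_filter hx]
      exact Finset.card_le_card (Finset.filter_subset_filter _
        (hTB.trans (Finset.coe_subset.1 hbA)))

/-- A polymatroid of the form `Y ↦ |⋃ j ∈ Y, S j|`, extended by the sets `Y` for which this union
contains `D`, determines an ideal family. -/
theorem isIdealFamily_of_sets {E J P : Type*} [Fintype E] [DecidableEq E] [Fintype J]
    [DecidableEq J] [Fintype P] [DecidableEq P] {block : J → Finset P}
    (hblock : IsBlockPartition block) {h : Finset J → ℕ} (hpos : ∀ j, 0 < h {j})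
    {Δ : Set (Finset J)} (hΔ : ∅ ∉ Δ) (S : J → Finset E) (D : Finset E)
    (hS : ∀ Y : Finset J, (Y.biUnion S).card = h Y)
    (hD : ∀ Y : Finset J, D ⊆ Y.biUnion S ↔ Y ∈ Δ) :
    IsIdealFamily (determinedFamily block h Δ) := by
  obtain ⟨q, hq, hprime⟩ :=
    Nat.exists_infinite_primes (Fintype.card (Finset P × Finset J × Bool) + 1)
  have : Fact q.Prime := ⟨hprime⟩
  let b := Pi.basisFun (ZMod q) E
  let W : J → Submodule (ZMod q) (E → ZMod q) := fun j => Submodule.span (ZMod q) (b '' S j)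
  let a : E → ZMod q := fun e => if e ∈ D then 1 else 0
  have hWsup : ∀ Y : Finset J, Y.sup W = Submodule.span (ZMod q) (b '' (Y.biUnion S)) := by
    intro Y
    induction Y using Finset.induction_on with
    | empty => simp
    | insert j Y hj ih =>
      rw [Finset.sup_insert, ih, Finset.biUnion_insert, Finset.coe_union, Set.image_union,
        Submodule.span_union]
  have hW : ∀ Y : Finset J, finrank (ZMod q) ↥(Y.sup W) = h Y := by
    intro Y
    have hli := b.linearIndependent.comp (fun e : (Y.biUnion S : Finset E) => (e : E))
      Subtype.val_injective
    have := finrank_span_eq_card hli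
    rw [Set.range_comp, Subtype.range_coe_subtype, Finset.setOfPred_mem, Fintype.card_coe] at this
    rw [hWsup, ← hS]
    exact this
  have ha : ∀ Y : Finset J, a ∈ Y.sup W ↔ Y ∈ Δ := by
    intro Y
    rw [hWsup, b.mem_span_image, ← hD, Finset.coe_subset]
    have : (b.repr a).support = D := by
      ext e
      simp [b, a]
    rw [this]
  obtain ⟨v, hv, hspan⟩ := exists_realization_of_subspaces (F := ZMod q)
    (by rw [Nat.card_zmod]; omega) hblock hpos W a hW ha
  refine isIdealFamily_of_mem_span (K := ZMod q) _ v a ?_ hv hspan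
  intro h0
  refine hΔ ((ha ∅).1 ?_)
  rw [h0]
  exact zero_mem _

end Representation

/-! ### Uniform polymatroids with constant increments after the first one -/

/-- Submodularity at `X ∪ {x₀}` and `Y ∪ {x₀}`: of the four sets, only the intersection gains rank
from `x₀`. -/
theorem IsCompatible.submodular {J : Type*} [DecidableEq J] {h : Finset J → ℕ}
    {Δ : Set (Finset J)} (hΔ : IsCompatible h Δ) {X Y : Finset J} (hX : X ∈ Δ) (hY : Y ∈ Δ) (hXY : X ∩ Y ∉ Δ) :
    h (X ∩ Y) + 1 + h (X ∪ Y) ≤ h X + h Y := by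
  have hu : X ∪ Y ∈ Δ := hΔ.monotone _ _ Finset.subset_union_left hX
  have := hΔ.extension.submodular (Finset.insertNone X) (Finset.insertNone Y)
  have hi : Finset.eraseNone (Finset.insertNone X ∩ Finset.insertNone Y) = X ∩ Y := by
    rw [Finset.eraseNone_inter]
    simp
  have hu' : Finset.eraseNone (Finset.insertNone X ∪ Finset.insertNone Y) = X ∪ Y := by
    rw [Finset.eraseNone_union]
    simp
  simp only [extensionRank, hi, hu', Finset.eraseNone_insertNone] at this
  simpa [hX, hY, hXY, hu] using this

section UniformPolymatroid

variable {J : Type*} [Fintype J] [DecidableEq J]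

theorem IsIncrementSequence.rank_insert {h : Finset J → ℕ}
    {g : Fin (Fintype.card J + 1) → ℕ} (hg : IsIncrementSequence h g) {X : Finset J} {j : J}
    (hj : j ∉ X) (i : Fin (Fintype.card J + 1)) (hi : (i : ℕ) = X.card) :
    h (insert j X) = h X + g i := by
  have hc := Finset.card_insert_of_notMem hj
  have hlt : X.card < Fintype.card J := by
    have := Finset.card_le_univ (insert j X)
    omega
  have := hg.1 ⟨X.card, hlt⟩ X (insert j X) rfl hc
  have hi' : i = Fin.castSucc ⟨X.card, hlt⟩ := Fin.ext hi
  rw [hi']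
  omega

theorem IsIncrementSequence.succ_le {h : Finset J → ℕ} (hh : IsPolymatroid h)
    {g : Fin (Fintype.card J + 1) → ℕ} (hg : IsIncrementSequence h g) (i : ℕ)
    (hi : i + 1 < Fintype.card J) : g ⟨i + 1, by omega⟩ ≤ g ⟨i, by omega⟩ := by
  obtain ⟨X, -, hX⟩ := Finset.exists_subset_card_eq (s := (Finset.univ : Finset J)) (n := i)
    (by rw [Finset.card_univ]; omega)
  obtain ⟨a, b, ha, hb, hab⟩ : ∃ a b, a ∉ X ∧ b ∉ X ∧ a ≠ b := by
    have : 1 < Xᶜ.card := by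
      rw [Finset.card_compl]
      omega
    obtain ⟨a, ha, b, hb, hab⟩ := Finset.one_lt_card.1 this
    exact ⟨a, b, Finset.mem_compl.1 ha, Finset.mem_compl.1 hb, hab⟩
  have hb' : b ∉ insert a X := by
    simp [hab.symm, hb]
  have h1 := hg.rank_insert ha ⟨i, by omega⟩ hX.symm
  have h2 := hg.rank_insert hb ⟨i, by omega⟩ hX.symm
  have h3 := hg.rank_insert hb' ⟨i + 1, by omega⟩
    (by rw [Finset.card_insert_of_notMem ha, hX])
  have h4 := hh.submodular (insert a X) (insert b X)
  have h5 : insert a X ∩ insert b X = X := by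
    ext e
    simp only [Finset.mem_inter, Finset.mem_insert]
    constructor
    · rintro ⟨rfl | he, rfl | he'⟩
      · exact absurd rfl hab
      all_goals assumption
    · exact fun he => ⟨Or.inr he, Or.inr he⟩
  have h6 : insert a X ∪ insert b X = insert b (insert a X) := by
    ext e
    simp only [Finset.mem_union, Finset.mem_insert]
    tauto
  rw [h5, h6] at h4
  omega

theorem IsUniformPolymatroid.rank_eq {h : Finset J → ℕ} (hh : IsUniformPolymatroid h)
    {g : Fin (Fintype.card J + 1) → ℕ} (hg : IsIncrementSequence h g)
    {a b c : Fin (Fintype.card J + 1)} (ha : (a : ℕ) = 0) (hb : (b : ℕ) = 1)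
    (hc : (c : ℕ) + 1 = Fintype.card J) (hab : g b ≤ g a) (hbc : g b = g c) (hpos : 0 < g c) :
    ∃ k r : ℕ, 0 < k ∧ ∀ X : Finset J, h X = X.card * k + if X.Nonempty then r else 0 := by
  have hp := hh.toIsPolymatroid
  have hanti : ∀ d i : ℕ, ∀ hi : i + d < Fintype.card J,
      g ⟨i + d, by omega⟩ ≤ g ⟨i, by omega⟩ := by
    intro d
    induction d with
    | zero => exact fun i hi => le_rfl
    | succ d ih =>
      exact fun i hi => (hg.succ_le hp (i + d) hi).trans (ih i (by omega))
  have hconst : ∀ i : Fin (Fintype.card J + 1), 1 ≤ (i : ℕ) → (i : ℕ) < Fintype.card J →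
      g i = g b := by
    intro i hi hlt
    obtain ⟨d, hd⟩ := Nat.exists_eq_add_of_le hi
    obtain ⟨e, he⟩ := Nat.exists_eq_add_of_lt hlt
    have h1 := hanti d 1 (by omega)
    have h2 := hanti e i (by omega)
    have hb' : b = ⟨1, by omega⟩ := Fin.ext hb
    have hi' : i = ⟨1 + d, by omega⟩ := Fin.ext hd
    have hc' : c = ⟨i + e, by omega⟩ := Fin.ext (by simp only; omega)
    rw [← hb', ← hi'] at h1
    rw [← hc'] at h2
    exact le_antisymm h1 (hbc.trans_le h2)
  -- The truncated subtraction is exact because `g b ≤ g a`.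
  refine ⟨g b, g a - g b, hbc ▸ hpos, fun X => ?_⟩
  induction X using Finset.induction_on with
  | empty => simp [hp.empty]
  | insert j X hj ih =>
    have hcard := Finset.card_insert_of_notMem hj
    have hle := Finset.card_le_univ (insert j X)
    rw [hcard, add_mul, one_mul, if_pos (Finset.insert_nonempty _ _)]
    rcases X.eq_empty_or_nonempty with rfl | hX
    · rw [hg.rank_insert hj a (by rw [ha, Finset.card_empty]), hp.empty, Finset.card_empty]
      omega
    · rw [hg.rank_insert hj ⟨X.card, by omega⟩ rfl, ih,
        hconst ⟨X.card, by omega⟩ hX.card_pos (by simp only; omega), if_pos hX]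
      omega

/-- The families compatible with a uniform polymatroid whose increments are constant after the
first one: those generated by one set, and the family of all nonempty sets. -/
theorem IsCompatible.eq_principal_or_nonempty {h : Finset J → ℕ} {Δ : Set (Finset J)}
    (hΔ : IsCompatible h Δ) (hne : Δ.Nonempty) {k r : ℕ}
    (hh : ∀ X : Finset J, h X = X.card * k + if X.Nonempty then r else 0) :
    (∃ X : Finset J, X.Nonempty ∧ ∀ Y, X ⊆ Y ↔ Y ∈ Δ) ∨
      (0 < r ∧ ∀ Y : Finset J, Y.Nonempty ↔ Y ∈ Δ) := by
  have hnonempty : ∀ X ∈ Δ, X.Nonempty := by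
    intro X hX
    rw [Finset.nonempty_iff_ne_empty]
    rintro rfl
    exact hΔ.empty_notMem hX
  have hcard : ∀ X Y : Finset J, (X ∪ Y).card * k + (X ∩ Y).card * k = X.card * k + Y.card * k :=
    fun X Y => by rw [← add_mul, ← add_mul, Finset.card_union_add_card_inter]
  -- When the intersection is nonempty the `r` terms cancel, so `h` is modular on the pair and
  -- leaves no room for the extra `1`.
  have hinter : ∀ X ∈ Δ, ∀ Y ∈ Δ, (X ∩ Y).Nonempty → X ∩ Y ∈ Δ := by
    intro X hX Y hY hXY
    by_contra hn
    have h1 := hΔ.submodular hX hY hn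
    rw [hh, hh, hh, hh, if_pos hXY, if_pos (hnonempty X hX), if_pos (hnonempty Y hY),
      if_pos (hXY.mono (Finset.inter_subset_left.trans Finset.subset_union_left))] at h1
    have := hcard X Y
    omega
  by_cases hdisj : ∃ X ∈ Δ, ∃ Y ∈ Δ, X ∩ Y = ∅
  · right
    obtain ⟨X, hX, Y, hY, hXY⟩ := hdisj
    constructor
    · have h1 := hΔ.submodular hX hY (hXY ▸ hΔ.empty_notMem)
      have h2 := hcard X Y
      rw [hh, hh, hh, hh, if_pos (hnonempty X hX), if_pos (hnonempty Y hY),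
        if_pos ((hnonempty X hX).mono Finset.subset_union_left)] at h1
      omega
    · refine fun Z => ⟨?_, hnonempty Z⟩
      rintro ⟨j, hj⟩
      -- Adding `j` to two disjoint members yields members meeting exactly in `{j}`, so every
      -- singleton lies in `Δ`.
      have h1 : insert j X ∩ insert j Y = {j} := by
        rw [← Finset.insert_inter_distrib, hXY, insert_empty_eq]
      refine hΔ.monotone {j} Z (by simpa) ?_
      rw [← h1]
      refine hinter _ (hΔ.monotone X _ (Finset.subset_insert _ _) hX) _
        (hΔ.monotone Y _ (Finset.subset_insert _ _) hY) ?_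
      rw [h1]
      exact Finset.singleton_nonempty j
  · left
    push Not at hdisj
    obtain ⟨X₀, hX₀⟩ := hne
    -- Now `Δ` is closed under intersection, so a minimal member is the least one.
    obtain ⟨X, -, hX⟩ := exists_minimal_le_of_wellFoundedLT (· ∈ Δ) X₀ hX₀
    refine ⟨X, hnonempty X hX.prop, fun Y => ⟨fun hXY => hΔ.monotone X Y hXY hX.prop,
      fun hY => ?_⟩⟩
    have := hinter X hX.prop Y hY (hdisj X hX.prop Y hY)
    exact (hX.le_of_le this Finset.inter_subset_left).trans Finset.inter_subset_right

end UniformPolymatroid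

/-! ### Explicit representation, access structure property and conclusion -/

/-- The set of basis vectors spanning the `j`-th subspace in a representation of the polymatroid
`X ↦ |X| * k + r` (`X ≠ ∅`): `r` common vectors and `k` vectors of its own. -/
def commonAndOwn {J : Type*} (k r : ℕ) (j : J) : Finset (Fin r ⊕ J × Fin k) :=
  Finset.univ.disjSum ({j} ×ˢ Finset.univ)

theorem biUnion_commonAndOwn {J : Type*} [DecidableEq J] (k r : ℕ) (Y : Finset J) :
    Y.biUnion (commonAndOwn k r) =
      Finset.disjSum (if Y.Nonempty then Finset.univ else ∅) (Y ×ˢ Finset.univ) := by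
  ext e
  rcases e with e | ⟨j, i⟩
  · by_cases hY : Y.Nonempty
    · simp [commonAndOwn, hY, hY.exists_mem]
    · simp [Finset.not_nonempty_iff_eq_empty.1 hY]
  · simp [commonAndOwn]

theorem card_biUnion_commonAndOwn {J : Type*} [DecidableEq J] (k r : ℕ) (Y : Finset J) :
    (Y.biUnion (commonAndOwn k r)).card = Y.card * k + if Y.Nonempty then r else 0 := by
  rw [biUnion_commonAndOwn, Finset.card_disjSum, Finset.card_product, Finset.card_univ,
    Fintype.card_fin, add_comm]
  split_ifs <;> simp

theorem exists_base {J : Type*} [Fintype J] [DecidableEq J] {k r : ℕ} {h : Finset J → ℕ}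
    (hh : ∀ X : Finset J, h X = X.card * k + if X.Nonempty then r else 0) {X : Finset J}
    (hX : X.Nonempty) : (polyBases h X).Nonempty := by
  obtain ⟨j, hj⟩ := hX
  have hsum : ∀ Y : Finset J, (∑ x ∈ Y, ((if x ∈ X then k else 0) + if x = j then r else 0)) =
      (Y ∩ X).card * k + if j ∈ Y then r else 0 := fun Y => by
    rw [Finset.sum_add_distrib, Finset.sum_ite_mem, Finset.sum_const, smul_eq_mul,
      Finset.sum_ite_eq']
  -- Weight `k` on each point of `X`, and the common `r` placed on a single `j ∈ X`.
  refine ⟨fun x => (if x ∈ X then k else 0) + if x = j then r else 0, fun x hx => ?_, ?_,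
    fun Y hY => ?_⟩
  · by_contra hn
    refine hx ?_
    change (if x ∈ X then k else 0) + (if x = j then r else 0) = 0
    rw [if_neg hn, if_neg (ne_of_mem_of_not_mem hj hn).symm]
  · rw [hsum, hh, if_pos (Finset.mem_univ j), if_pos (show X.Nonempty from ⟨j, hj⟩),
      Finset.univ_inter]
  · rw [hsum, hh, Finset.inter_eq_left.2 hY]
    by_cases hjY : j ∈ Y
    · rw [if_pos hjY, if_pos (show Y.Nonempty from ⟨j, hjY⟩)]
    · rw [if_neg hjY]
      omega

theorem isAccessStructure_determinedFamily {J P : Type*} [Fintype J] [Fintype P] [DecidableEq P]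
    {block : J → Finset P} {h : Finset J → ℕ} (hsize : ∀ x, h {x} ≤ (block x).card)
    {Δ : Set (Finset J)} (hne : Δ.Nonempty) (hpos : ∀ X ∈ Δ, 0 < h X)
    (hbase : ∀ X ∈ Δ, (polyBases h X).Nonempty) :
    IsAccessStructure (determinedFamily block h Δ) where
  monotone A B hAB hA := by
    obtain ⟨w, hw, hwA⟩ := hA
    exact ⟨w, hw, hwA.trans fun x =>
      Finset.card_le_card (Finset.inter_subset_inter_right hAB)⟩
  empty_notMem := by
    rw [mem_determinedFamily_iff]
    rintro ⟨X, hX, w, ⟨-, hw, -⟩, hle⟩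
    have hw0 : ∀ x, w x = 0 := fun x => by simpa [blockVector] using hle x
    have := hpos X hX
    simp [hw0] at hw
    omega
  univ_mem := by
    obtain ⟨X, hX⟩ := hne
    obtain ⟨w, hw⟩ := hbase X hX
    refine mem_determinedFamily_iff.2 ⟨X, hX, w, hw, fun x => ?_⟩
    rw [blockVector, Finset.univ_inter]
    by_cases hx : w x = 0
    · exact hx.trans_le (Nat.zero_le _)
    · have := hw.2.2 {x} (Finset.singleton_subset_iff.2 (hw.1 x hx))
      rw [Finset.sum_singleton] at this
      exact this.trans (hsize x)

theorem mainTheorem12 {J P : Type*} [Fintype J] [DecidableEq J] [Fintype P] [DecidableEq P]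
    (hJ : 3 ≤ Fintype.card J)
    (block : J → Finset P) (hblock : IsBlockPartition block)
    (h : Finset J → ℕ) (hh : IsUniformPolymatroid h)
    (g : Fin (Fintype.card J + 1) → ℕ) (hg : IsIncrementSequence h g)
    (h01 : g ⟨1, by omega⟩ ≤ g ⟨0, by omega⟩)
    (h1m : g ⟨1, by omega⟩ = g ⟨Fintype.card J - 1, by omega⟩)
    (hpos : 0 < g ⟨Fintype.card J - 1, by omega⟩)
    (hsize : ∀ x, h {x} ≤ (block x).card)
    (Δ : Set (Finset J)) (hΔ : IsCompatible h Δ) (hne : Δ.Nonempty) :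
    IsAccessStructure (determinedFamily block h Δ) ∧
      IsIdealFamily (determinedFamily block h Δ) := by
  obtain ⟨k, r, hk, hrank⟩ := hh.rank_eq hg rfl rfl (Nat.sub_add_cancel (le_trans (by decide) hJ))
    h01 h1m hpos
  have hnonempty : ∀ X ∈ Δ, X.Nonempty := by
    intro X hX
    rw [Finset.nonempty_iff_ne_empty]
    rintro rfl
    exact hΔ.empty_notMem hX
  have hrank_pos : ∀ X : Finset J, X.Nonempty → 0 < h X := by
    intro X hX
    rw [hrank]
    exact Nat.add_pos_left (Nat.mul_pos hX.card_pos hk) _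
  refine ⟨isAccessStructure_determinedFamily hsize hne (fun X hX => hrank_pos X (hnonempty X hX))
    fun X hX => exists_base hrank (hnonempty X hX), ?_⟩
  obtain ⟨D, hD⟩ : ∃ D : Finset (Fin r ⊕ J × Fin k),
      ∀ Y : Finset J, D ⊆ Y.biUnion (commonAndOwn k r) ↔ Y ∈ Δ := by
    rcases hΔ.eq_principal_or_nonempty hne hrank with ⟨X, -, hX⟩ | ⟨hr, hY⟩
    -- Principal case: one private vector for each point of the generator. In the other case a
    -- single common vector suffices, as every nonempty union contains it.
    · refine ⟨X.image fun j => Sum.inr (j, ⟨0, hk⟩), fun Y => ?_⟩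
      rw [← hX, biUnion_commonAndOwn, Finset.image_subset_iff]
      simp [Finset.subset_iff]
    · refine ⟨{Sum.inl ⟨0, hr⟩}, fun Y => ?_⟩
      rw [← hY, biUnion_commonAndOwn, Finset.singleton_subset_iff, Finset.inl_mem_disjSum]
      split_ifs with hYne <;> simp [hYne]
  exact isIdealFamily_of_sets hblock (fun j => hrank_pos _ (Finset.singleton_nonempty j))
    hΔ.empty_notMem (commonAndOwn k r) D
    (fun Y => (card_biUnion_commonAndOwn k r Y).trans (hrank Y).symm) hD
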